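/- Let $H$ be a complex Hilbert space and let $T\in\mathbb{B}(H)$ be a bounded linear operator satisfying $(T-aI)(T-bI)=0$ for some $a,b\in\mathbb{C}$ (such a $T$ is called quadratic; $a=b$ is allowed). Then there exist complex Hilbert spaces $K_1,K_2,K_3$ (possibly zero), a unitary operator $W:H\to K_1\oplus K_2\oplus K_3\oplus K_3$ (Hilbert space direct sum) and a positive (semidefinite) operator $B\in\mathbb{B}(K_3)$ with trivial kernel $\mathcal{N}(B)=\{0\}$ such that $$WTW^*=aI_{K_1}\oplus bI_{K_2}\oplus\begin{pmatrix} aI_{K_3} & B\\ 0 & bI_{K_3}\end{pmatrix}.$$ -/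

import Mathlib

universe u

noncomputable section

/-- The Hilbert space direct sum `E ⊕ F`, with `⟪(x₁, y₁), (x₂, y₂)⟫ = ⟪x₁, x₂⟫ + ⟪y₁, y₂⟫`. -/
abbrev HilbertSum (E F : Type*) : Type _ := WithLp 2 (E × F)

section Block

variable {E F : Type*} [NormedAddCommGroup E] [InnerProductSpace ℂ E]
  [NormedAddCommGroup F] [InnerProductSpace ℂ F]

/-- The operator on `E ⊕ F` given by the `2 × 2` block matrix with rows `(A, B)` and `(C, D)`. -/
def blockMatrix (A : E →L[ℂ] E) (B : F →L[ℂ] E) (C : E →L[ℂ] F) (D : F →L[ℂ] F) :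
    HilbertSum E F →L[ℂ] HilbertSum E F :=
  ((WithLp.prodContinuousLinearEquiv 2 ℂ E F).symm : (E × F) →L[ℂ] HilbertSum E F) ∘L
    ((A.coprod B).prod (C.coprod D)) ∘L
      ((WithLp.prodContinuousLinearEquiv 2 ℂ E F) : HilbertSum E F →L[ℂ] (E × F))

/-- The direct sum `A ⊕ D` of two operators, i.e. the block diagonal operator on `E ⊕ F`. -/
def directSumOp (A : E →L[ℂ] E) (D : F →L[ℂ] F) : HilbertSum E F →L[ℂ] HilbertSum E F :=
  blockMatrix A 0 0 D

theorem blockMatrix_apply (A : E →L[ℂ] E) (B : F →L[ℂ] E) (C : E →L[ℂ] F) (D : F →L[ℂ] F)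
    (x : E) (y : F) :
    blockMatrix A B C D (WithLp.toLp 2 (x, y)) = WithLp.toLp 2 (A x + B y, C x + D y) := rfl

theorem directSumOp_apply (A : E →L[ℂ] E) (D : F →L[ℂ] F) (x : E) (y : F) :
    directSumOp A D (WithLp.toLp 2 (x, y)) = WithLp.toLp 2 (A x, D y) := by
  simp [directSumOp, blockMatrix_apply]

end Block

end

section Polar

variable {E F : Type*} [NormedAddCommGroup E] [InnerProductSpace ℂ E]
  [NormedAddCommGroup F] [InnerProductSpace ℂ F]

/-! Let `M = ker (T - a)` and let `D` be `T - b` on `Mᗮ` and zero on `M`. Since `(T - a)(T - b) =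
0`, `D` takes values in `M`, so `T` is `a` on `M` and `b + D` on `Mᗮ` (`exists_squareZero_part`).
Split `M` along the closure of `ran D`, and `Mᗮ` along `ker D`: this leaves `M ⊓ (ran D)ᗮ`, where `T
= a`, `Mᗮ ⊓ ker D`, where `T = b`, and the pair formed by the closure of `ran D` and `(ker D)ᗮ`
(`exists_decomposition`). The polar decomposition `D = U|D|` identifies the members of this pair
with a single space `K₃ = (ker D)ᗮ`, on which `B = |D|` is positive and injective
(`exists_polar_decomposition`). -/

theorem mem_topologicalClosure_range (f : E →L[ℂ] F) (x : E) :
    (f : E →ₗ[ℂ] F) x ∈ f.range.topologicalClosure :=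
  f.range.le_topologicalClosure ⟨x, rfl⟩

theorem denseRange_codRestrict_topologicalClosure (f : E →L[ℂ] F) :
    DenseRange ((f : E →ₗ[ℂ] F).codRestrict f.range.topologicalClosure
      (mem_topologicalClosure_range f)) := by
  rintro ⟨y, hy⟩
  rw [closure_subtype]
  have hy' : y ∈ closure (f.range : Set F) := hy
  convert! hy' using 2
  ext z
  simp only [Set.mem_image, Set.mem_range, SetLike.mem_coe, LinearMap.mem_range]
  constructor
  · rintro ⟨_, ⟨x, rfl⟩, rfl⟩
    exact ⟨x, rfl⟩
  · rintro ⟨x, rfl⟩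
    exact ⟨_, ⟨x, rfl⟩, rfl⟩

/-- Two operators with pointwise equal norms have unitarily equivalent closures of ranges. -/
theorem exists_linearIsometryEquiv_closure_range {G : Type*} [NormedAddCommGroup G]
    [InnerProductSpace ℂ G] [CompleteSpace F] [CompleteSpace G] (f : E →L[ℂ] F) (g : E →L[ℂ] G)
    (h : ∀ x, ‖g x‖ = ‖f x‖) :
    ∃ U : f.range.topologicalClosure ≃ₗᵢ[ℂ] g.range.topologicalClosure,
      ∀ x, ∀ hx : f x ∈ f.range.topologicalClosure, (U ⟨f x, hx⟩ : G) = g x := by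
  -- Equal norms make `f x ↦ g x` a well-defined isometry between dense subspaces of the two
  -- closures; it extends by completeness.
  refine ⟨(LinearEquiv.refl ℂ E).extendOfIsometry _ _
    (denseRange_codRestrict_topologicalClosure f)
    (denseRange_codRestrict_topologicalClosure g) (fun x ↦ h x), fun x hx ↦ ?_⟩
  exact congrArg Subtype.val (LinearEquiv.extendOfIsometry_eq (LinearEquiv.refl ℂ E) _ _
    (denseRange_codRestrict_topologicalClosure f)
    (denseRange_codRestrict_topologicalClosure g) (fun x ↦ h x) x)

variable [CompleteSpace E]

/-- `|D|` is self-adjoint and `|D|² = D*D`, so both squared norms equal `⟪D*D x, x⟫`. -/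
theorem norm_cfcAbs_apply (D : E →L[ℂ] E) (x : E) : ‖CFC.abs D x‖ = ‖D x‖ := by
  have hA : ContinuousLinearMap.adjoint (CFC.abs D) = CFC.abs D :=
    (CFC.abs_nonneg D).isSelfAdjoint
  have h : inner ℂ (CFC.abs D x) (CFC.abs D x) = inner ℂ (D x) (D x) := by
    rw [← ContinuousLinearMap.adjoint_inner_left, ← ContinuousLinearMap.adjoint_inner_left, hA]
    exact congrArg (fun S : E →L[ℂ] E ↦ inner ℂ (S x) x) (CFC.abs_mul_abs D)
  rw [inner_self_eq_norm_sq_to_K, inner_self_eq_norm_sq_to_K] at h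
  exact (sq_eq_sq₀ (norm_nonneg _) (norm_nonneg _)).1 (by exact_mod_cast h)

theorem ker_cfcAbs (D : E →L[ℂ] E) : (CFC.abs D).ker = D.ker := by
  ext x
  change CFC.abs D x = 0 ↔ D x = 0
  rw [← norm_eq_zero, norm_cfcAbs_apply, norm_eq_zero]

theorem topologicalClosure_range_cfcAbs (D : E →L[ℂ] E) :
    (CFC.abs D).range.topologicalClosure = D.kerᗮ := by
  have hA : ContinuousLinearMap.adjoint (CFC.abs D) = CFC.abs D :=
    (CFC.abs_nonneg D).isSelfAdjoint
  rw [← ker_cfcAbs, ContinuousLinearMap.orthogonal_ker, hA]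

/-- Polar decomposition: `D` restricted to the orthogonal complement of its kernel is an injective
positive operator followed by a unitary onto the closure of the range of `D`. -/
theorem exists_polar_decomposition (D : E →L[ℂ] E) :
    ∃ (U : D.kerᗮ ≃ₗᵢ[ℂ] D.range.topologicalClosure) (B : D.kerᗮ →L[ℂ] D.kerᗮ),
      B.IsPositive ∧ B.ker = ⊥ ∧ ∀ w, (U (B w) : E) = D w := by
  have hmem : ∀ x, CFC.abs D x ∈ D.kerᗮ := fun x ↦ by
    rw [← topologicalClosure_range_cfcAbs]
    exact mem_topologicalClosure_range _ x
  obtain ⟨U, hU⟩ : ∃ U : D.kerᗮ ≃ₗᵢ[ℂ] D.range.topologicalClosure,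
      ∀ x, ∀ hx : CFC.abs D x ∈ D.kerᗮ, (U ⟨CFC.abs D x, hx⟩ : E) = D x := by
    rw [← topologicalClosure_range_cfcAbs]
    exact exists_linearIsometryEquiv_closure_range (CFC.abs D) D
      fun x ↦ (norm_cfcAbs_apply D x).symm
  have hpos : (CFC.abs D).IsPositive :=
    (ContinuousLinearMap.nonneg_iff_isPositive _).1 (CFC.abs_nonneg D)
  refine ⟨U, (CFC.abs D ∘L D.kerᗮ.subtypeL).codRestrict D.kerᗮ fun w ↦ hmem w, ?_, ?_, ?_⟩
  · exact ⟨fun x y ↦ hpos.1 (x : E) (y : E), fun x ↦ hpos.2 (x : E)⟩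
  · refine (Submodule.eq_bot_iff _).2 fun w hw ↦ ?_
    have h0 : CFC.abs D (w : E) = 0 := congrArg Subtype.val hw
    have hk : (w : E) ∈ D.ker := (ker_cfcAbs D).le h0
    exact Subtype.ext (inner_self_eq_zero.1 (w.2 (w : E) hk))
  · exact fun w ↦ hU w (hmem w)

end Polar

section Decomposition

variable {E F G : Type*} [NormedAddCommGroup E] [InnerProductSpace ℂ E]
  [NormedAddCommGroup F] [InnerProductSpace ℂ F] [NormedAddCommGroup G] [InnerProductSpace ℂ G]

/-- Isometries into `G` with orthogonal ranges combine to an isometry of the direct sum. -/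
noncomputable def LinearIsometry.hilbertSumCoprod (f : E →ₗᵢ[ℂ] G) (g : F →ₗᵢ[ℂ] G)
    (h : ∀ x y, inner ℂ (f x) (g y) = 0) : HilbertSum E F →ₗᵢ[ℂ] G where
  toLinearMap := f.toLinearMap.coprod g.toLinearMap ∘ₗ (WithLp.linearEquiv 2 ℂ (E × F)).toLinearMap
  norm_map' v := by
    rw [← sq_eq_sq₀ (norm_nonneg _) (norm_nonneg _), WithLp.prod_norm_sq_eq_of_L2,
      ← f.norm_map, ← g.norm_map, sq, sq, sq]
    exact norm_add_sq_eq_norm_sq_add_norm_sq_of_inner_eq_zero _ _ (h _ _)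

theorem LinearIsometry.hilbertSumCoprod_apply (f : E →ₗᵢ[ℂ] G) (g : F →ₗᵢ[ℂ] G)
    (h : ∀ x y, inner ℂ (f x) (g y) = 0) (x : E) (y : F) :
    f.hilbertSumCoprod g h (WithLp.toLp 2 (x, y)) = f x + g y := rfl

end Decomposition

section Quadratic

variable {H : Type*} [NormedAddCommGroup H] [InnerProductSpace ℂ H] [CompleteSpace H]

/-- `D` maps the orthogonal complement of a closed subspace `M` into `M`, and annihilates `M`. The
space splits accordingly, with the closure of the range of `D` identified with the orthogonal
complement of its kernel. -/
theorem exists_decomposition (M : Submodule ℂ H) [M.HasOrthogonalProjection] (D : H →L[ℂ] H)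
    (hR : D.range.topologicalClosure ≤ M) (hM : M ≤ D.ker)
    (U : D.kerᗮ ≃ₗᵢ[ℂ] D.range.topologicalClosure) :
    ∃ V : HilbertSum ↥(M ⊓ D.rangeᗮ) (HilbertSum ↥(Mᗮ ⊓ D.ker) (HilbertSum D.kerᗮ D.kerᗮ))
        ≃ₗᵢ[ℂ] H,
      ∀ x y z w, V (WithLp.toLp 2 (x, WithLp.toLp 2 (y, WithLp.toLp 2 (z, w)))) =
        x + (y + (U z + w)) := by
  have hN : D.kerᗮ ≤ Mᗮ := Submodule.orthogonal_le hM
  have hRc : D.rangeᗮ = D.range.topologicalClosureᗮ := (Submodule.orthogonal_closure _).symm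
  let V₁ := (D.range.topologicalClosure.subtypeₗᵢ.comp U.toLinearIsometry).hilbertSumCoprod
    D.kerᗮ.subtypeₗᵢ fun z w ↦ hN w.2 _ (hR (U z).2)
  let V₂ := (Mᗮ ⊓ D.ker).subtypeₗᵢ.hilbertSumCoprod V₁ fun y v ↦ by
    change inner ℂ (y : H) ((U v.fst : H) + (v.snd : H)) = 0
    rw [inner_add_right, v.snd.2 _ y.2.2, inner_eq_zero_symm.1 (y.2.1 _ (hR (U v.fst).2)), add_zero]
  let V₃ := (M ⊓ D.rangeᗮ).subtypeₗᵢ.hilbertSumCoprod V₂ fun x v ↦ by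
    change inner ℂ (x : H) ((v.fst : H) + ((U v.snd.fst : H) + (v.snd.snd : H))) = 0
    rw [inner_add_right, inner_add_right, v.fst.2.1 _ x.2.1, hN v.snd.snd.2 _ x.2.1,
      inner_eq_zero_symm.1 (hRc.le x.2.2 _ (U v.snd.fst).2), add_zero, add_zero]
  have hV : ∀ x y z w, V₃ (WithLp.toLp 2 (x, WithLp.toLp 2 (y, WithLp.toLp 2 (z, w)))) =
      x + (y + (U z + w)) := fun _ _ _ _ ↦ rfl
  refine ⟨LinearIsometryEquiv.ofSurjective V₃ fun h ↦ ?_, hV⟩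
  -- Surjectivity: since the closure of `ran D` lies in `M` and `(ker D)ᗮ` in `Mᗮ`, the other
  -- summand of each finer splitting stays in `M` or `Mᗮ`.
  obtain ⟨m, hm, n, hn, rfl⟩ := M.exists_add_mem_mem_orthogonal h
  obtain ⟨r, hr, x, hx, rfl⟩ := D.range.topologicalClosure.exists_add_mem_mem_orthogonal m
  obtain ⟨y, hy, w, hw, rfl⟩ := D.ker.exists_add_mem_mem_orthogonal n
  have hxM : x ∈ M := (Submodule.add_mem_iff_right _ (hR hr)).1 hm
  have hyM : y ∈ Mᗮ := (Submodule.add_mem_iff_left _ (hN hw)).1 hn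
  refine ⟨WithLp.toLp 2 (⟨x, hxM, hRc.ge hx⟩,
    WithLp.toLp 2 (⟨y, hyM, hy⟩, WithLp.toLp 2 (U.symm ⟨r, hr⟩, ⟨w, hw⟩))), ?_⟩
  rw [hV, U.apply_symm_apply]
  change x + (y + (r + w)) = r + x + (y + w)
  abel

/-- A quadratic operator is `a` on `M = ker (T - a)` and `b + D` on `Mᗮ`, where `D` is a square-zero
operator mapping `Mᗮ` into `M`. -/
theorem exists_squareZero_part (T : H →L[ℂ] H) (a b : ℂ)
    (hT : (T - a • ContinuousLinearMap.id ℂ H) ∘L (T - b • ContinuousLinearMap.id ℂ H) = 0) :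
    ∃ (M : Submodule ℂ H) (_ : M.HasOrthogonalProjection) (D : H →L[ℂ] H),
      D.range.topologicalClosure ≤ M ∧ M ≤ D.ker ∧ (∀ x ∈ M, T x = a • x) ∧
        ∀ y ∈ Mᗮ, T y = b • y + D y := by
  let S := T - a • ContinuousLinearMap.id ℂ H
  have hS : IsClosed (S.ker : Set H) := S.isClosed_ker
  have : CompleteSpace S.ker := hS.completeSpace_coe
  refine ⟨S.ker, inferInstance,
    (T - b • ContinuousLinearMap.id ℂ H) ∘L S.kerᗮ.starProjection, ?_, ?_, ?_, ?_⟩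
  · refine Submodule.topologicalClosure_minimal _ ?_ hS
    rintro _ ⟨x, rfl⟩
    exact congrArg (fun L : H →L[ℂ] H ↦ L (S.kerᗮ.starProjection x)) hT
  · intro x hx
    change (T - b • ContinuousLinearMap.id ℂ H) (S.kerᗮ.starProjection x) = 0
    rw [(Submodule.starProjection_apply_eq_zero_iff _).2
      (Submodule.le_orthogonal_orthogonal _ hx), map_zero]
  · exact fun x hx ↦ sub_eq_zero.1 (show T x - a • x = 0 from hx)
  · intro y hy
    change T y = b • y + (T - b • ContinuousLinearMap.id ℂ H) (S.kerᗮ.starProjection y)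
    rw [Submodule.starProjection_eq_self_iff.2 hy]
    exact (add_sub_cancel (b • y) (T y)).symm

end Quadratic

theorem mainTheorem10 {H : Type u} [NormedAddCommGroup H] [InnerProductSpace ℂ H]
    [CompleteSpace H] (T : H →L[ℂ] H) (a b : ℂ)
    (hT : (T - a • ContinuousLinearMap.id ℂ H) ∘L (T - b • ContinuousLinearMap.id ℂ H) = 0) :
    ∃ (K₁ K₂ K₃ : Type u)
      (_ : NormedAddCommGroup K₁) (_ : InnerProductSpace ℂ K₁) (_ : CompleteSpace K₁)
      (_ : NormedAddCommGroup K₂) (_ : InnerProductSpace ℂ K₂) (_ : CompleteSpace K₂)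
      (_ : NormedAddCommGroup K₃) (_ : InnerProductSpace ℂ K₃) (_ : CompleteSpace K₃)
      (W : H ≃ₗᵢ[ℂ] HilbertSum K₁ (HilbertSum K₂ (HilbertSum K₃ K₃)))
      (B : K₃ →L[ℂ] K₃),
      B.IsPositive ∧ B.ker = ⊥ ∧
      (W : H →L[ℂ] HilbertSum K₁ (HilbertSum K₂ (HilbertSum K₃ K₃))) ∘L T ∘L
          ContinuousLinearMap.adjoint
            (W : H →L[ℂ] HilbertSum K₁ (HilbertSum K₂ (HilbertSum K₃ K₃))) =
        directSumOp (a • ContinuousLinearMap.id ℂ K₁)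
          (directSumOp (b • ContinuousLinearMap.id ℂ K₂)
            (blockMatrix (a • ContinuousLinearMap.id ℂ K₃) B
              0 (b • ContinuousLinearMap.id ℂ K₃))) := by
  obtain ⟨M, _, D, hR, hM, hTa, hTb⟩ := exists_squareZero_part T a b hT
  obtain ⟨U, B, hB, hBker, hUB⟩ := exists_polar_decomposition D
  obtain ⟨V, hV⟩ := exists_decomposition M D hR hM U
  -- An orthogonal projection onto `M` forces `Mᗮᗮ = M`, hence `M` is closed.
  have hMc : M.topologicalClosure = M := by
    rw [← Submodule.orthogonal_orthogonal_eq_closure, Submodule.orthogonal_orthogonal]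
  have hMclosed : IsClosed (M : Set H) := hMc ▸ M.isClosed_topologicalClosure
  have h₁ : CompleteSpace ↥(M ⊓ D.rangeᗮ) :=
    (hMclosed.inter (Submodule.isClosed_orthogonal _)).completeSpace_coe
  have h₂ : CompleteSpace ↥(Mᗮ ⊓ D.ker) :=
    ((Submodule.isClosed_orthogonal _).inter D.isClosed_ker).completeSpace_coe
  refine ⟨↥(M ⊓ D.rangeᗮ), ↥(Mᗮ ⊓ D.ker), ↥D.kerᗮ, inferInstance, inferInstance, h₁,
    inferInstance, inferInstance, h₂, inferInstance, inferInstance, inferInstance, V.symm, B,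
    hB, hBker, ?_⟩
  rw [LinearIsometryEquiv.adjoint_eq_symm]
  ext1 v
  obtain ⟨x, y, z, w, rfl⟩ : ∃ x y z w,
      v = WithLp.toLp 2 (x, WithLp.toLp 2 (y, WithLp.toLp 2 (z, w))) := ⟨_, _, _, _, rfl⟩
  simp only [directSumOp_apply, blockMatrix_apply]
  change V.symm (T (V _)) = _
  -- The coordinate `z` enters `H` as `U z ∈ M`, where `T` is `a`; and `T w = b w + U (B w)`, whose
  -- last term has third coordinate `B w`, the off-diagonal entry.
  rw [LinearIsometryEquiv.symm_apply_eq, hV, hV, map_add, map_add, map_add, hTa x x.2.1,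
    hTb y y.2.1, hTa _ (hR (U z).2), hTb w (Submodule.orthogonal_le hM w.2),
    show D y = 0 from y.2.2, ← hUB w]
  simp only [map_add, smul_apply, ContinuousLinearMap.id_apply,
    zero_apply, map_smul, Submodule.coe_add, Submodule.coe_smul, zero_add,
    add_zero]
  abel
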